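/- Call $f:\mathbb R\to[0,\infty)$ a log-concave probability density if $\int_{\mathbb R} f\,dx=1$, the set $\{f>0\}$ is convex and $\log f$ is concave on it. Let $f$ and $g$ be log-concave probability densities on $\mathbb R$ that are differentiable with locally absolutely continuous derivative (for instance of class $C^2$), and put $$I(f)=\int_{\{f>0\}}\frac{f'(x)^2}{f(x)}\,dx,\qquad J(f)=\int_{\{f>0\}}\left[\left(\frac{f'(x)}{f(x)}\right)^2-\frac{f''(x)}{f(x)}\right]^2 f(x)\,dx .$$ Suppose that $J(f)<\infty$ and $J(g)<\infty$. Then the convolution $f*g$ is also differentiable with locally absolutely continuous derivative, $J(f*g)<\infty$, and for all real $a,b>0$ $$J(f*g)\le\frac{a^4}{(a+b)^4}J(f)+\frac{b^4}{(a+b)^4}J(g)+\frac{2a^2b^2}{(a+b)^4}I(f)I(g).$$ Moreover, for given $a,b>0$, equality holds if and only if, for some common constant $c>0$, $f$ and $g$ are Gaussian densities (with arbitrary means) of variances $ca$ and $cb$ respectively. -/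

import Mathlib

open MeasureTheory ProbabilityTheory Set
open scoped ENNReal NNReal

/-- `f` is a log-concave probability density on the real line: `f = exp (-Φ)` with `Φ` convex on
the (convex) set `{f > 0}`, `f ≥ 0`, and `f` has integral one. -/
structure IsLogConcaveDensity (f : ℝ → ℝ) : Prop where
  nonneg : ∀ x, 0 ≤ f x
  logConcave : ConcaveOn ℝ {x | 0 < f x} (fun x => Real.log (f x))
  integrable : Integrable f
  integral_eq_one : ∫ x, f x = 1

/-- `f` is differentiable and `f'` is locally absolutely continuous, so that `f''` exists almost
everywhere and is also the distributional second derivative of `f`. Every `C²` function has this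
property. -/
def HasLocallyACDeriv (f : ℝ → ℝ) : Prop :=
  Differentiable ℝ f ∧ ∀ p q : ℝ, AbsolutelyContinuousOnInterval (deriv f) p q

/-- Fisher information `I(f) = ∫_{f > 0} (f')² / f`, with values in `[0, ∞]`. -/
noncomputable def fisherI (f : ℝ → ℝ) : ℝ≥0∞ :=
  ∫⁻ x in {x | 0 < f x}, ENNReal.ofReal ((deriv f x) ^ 2 / f x)

/-- `J(f) = ∫_{f > 0} ((f'/f)² - f''/f)² f`, with values in `[0, ∞]`. -/
noncomputable def fisherJ (f : ℝ → ℝ) : ℝ≥0∞ :=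
  ∫⁻ x in {x | 0 < f x},
    ENNReal.ofReal (((deriv f x / f x) ^ 2 - deriv (deriv f) x / f x) ^ 2 * f x)

/-- The convolution `f * g` on the real line with respect to Lebesgue measure. -/
noncomputable def conv (f g : ℝ → ℝ) : ℝ → ℝ :=
  MeasureTheory.convolution f g (ContinuousLinearMap.mul ℝ ℝ) volume

open Filter Topology

/-! Let `X` and `Y` be independent with densities `f` and `g`, let `h = f * g` be the density of `X
+ Y`, and let `lam + mu = 1`. Both `score f X` and `score g Y` have conditional expectation `score h
z` given `X + Y = z`, hence so has their weighted sum S = `lam * score f X + mu * score g Y`. The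
second moment of S gives the pointwise identity (`integral_wscore_sub_sq`) curv h (z) = E[W | X + Y
= z] - Var(S | X + Y = z), with W = lam² curv f (X) + mu² curv g (Y). Since curv h ≥ 0
(`curv_conv_nonneg`, the log-concavity of `h`), dropping the variance and squaring is allowed, and
Cauchy-Schwarz gives (curv h)² ≤ E[W² | X + Y = z]. Averaging over z gives E[W²], which by
independence and E[curv f (X)] = I(f) is the right-hand side for `lam = a / (a + b)`, `mu = b / (a +
b)`.

Equality forces the conditional variance to vanish for almost every z, so S is a function of x + y
alone (`score_add_score_eq`). Then both scores are affine with slopes in a fixed ratio, and the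
densities are Gaussian. -/

/-- The score `f' / f`. -/
noncomputable def score (f : ℝ → ℝ) (x : ℝ) : ℝ := deriv f x / f x

/-- The curvature `(f' / f)² - f'' / f` of the potential `-log f`. -/
noncomputable def curv (f : ℝ → ℝ) (x : ℝ) : ℝ :=
  (deriv f x / f x) ^ 2 - deriv (deriv f) x / f x

/-! ### Absolutely continuous and integrable functions on the line -/

/-- An integrable locally absolutely continuous function with integrable derivative tends to
zero at both ends, so that its derivative has integral zero. -/
theorem integral_deriv_eq_zero_of_ac {F : ℝ → ℝ}
    (hF : ∀ p q : ℝ, AbsolutelyContinuousOnInterval F p q)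
    (hi : Integrable F) (hd : Integrable (deriv F)) : ∫ x, deriv F x = 0 := by
  have h0 : ∀ x, F x = F 0 + ∫ t in (0 : ℝ)..x, deriv F t := fun x => by
    rw [(hF 0 x).integral_deriv_eq_sub]; ring
  have ht : Tendsto F atTop (𝓝 (F 0 + ∫ t in Ioi 0, deriv F t)) := by
    have := (intervalIntegral_tendsto_integral_Ioi 0 hd.integrableOn tendsto_id).const_add (F 0)
    exact this.congr fun x => (h0 x).symm
  have hb : Tendsto F atBot (𝓝 (F 0 - ∫ t in Iic 0, deriv F t)) := by
    have := (intervalIntegral_tendsto_integral_Iic 0 hd.integrableOn tendsto_id).const_sub (F 0)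
    refine this.congr fun x => ?_
    rw [h0 x, id, intervalIntegral.integral_symm 0 x, sub_neg_eq_add]
  have ht0 := IntegrableAtFilter.eq_zero_of_tendsto (hi.integrableAtFilter atTop) (fun s hs => by
    obtain ⟨b, hb⟩ := mem_atTop_sets.1 hs
    rw [← top_le_iff, ← Real.volume_Ici (a := b)]
    exact measure_mono hb) ht
  have hb0 := IntegrableAtFilter.eq_zero_of_tendsto (hi.integrableAtFilter atBot) (fun s hs => by
    obtain ⟨b, hb⟩ := mem_atBot_sets.1 hs
    rw [← top_le_iff, ← Real.volume_Iic (a := b)]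
    exact measure_mono hb) hb
  have := integral_add_compl (μ := volume) (measurableSet_Iic (a := (0 : ℝ))) hd
  rw [compl_Iic] at this
  linarith

/-- A locally absolutely continuous function with integrable derivative is bounded. -/
theorem exists_bound_of_ac {F : ℝ → ℝ}
    (hF : ∀ p q : ℝ, AbsolutelyContinuousOnInterval F p q) (hd : Integrable (deriv F)) :
    ∃ C, ∀ x, ‖F x‖ ≤ C := by
  refine ⟨‖F 0‖ + ∫ x, ‖deriv F x‖, fun x => ?_⟩
  have h : F x = F 0 + ∫ t in (0 : ℝ)..x, deriv F t := by
    rw [(hF 0 x).integral_deriv_eq_sub]; ring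
  rw [h]
  refine (norm_add_le _ _).trans (add_le_add le_rfl ?_)
  refine (intervalIntegral.norm_integral_le_integral_norm_uIoc).trans ?_
  exact setIntegral_le_integral hd.norm (ae_of_all _ fun x => norm_nonneg _)

/-- Otherwise `f` would eventually be increasing and stay above a positive constant on a half-line.
The points found here serve as endpoints at which `f'` has a usable sign. -/
theorem frequently_deriv_nonpos_atTop {f : ℝ → ℝ} (hd : Differentiable ℝ f) (h0 : ∀ x, 0 ≤ f x)
    (hi : Integrable f) : ∃ᶠ x in atTop, deriv f x ≤ 0 := by
  intro H
  obtain ⟨M, hM⟩ := eventually_atTop.1 H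
  have hmono : StrictMonoOn f (Ici M) :=
    strictMonoOn_of_deriv_pos (convex_Ici M) hd.continuous.continuousOn fun x hx => by
      rw [interior_Ici] at hx
      exact not_le.1 (hM x hx.le)
  have h1 : 0 < f (M + 1) :=
    (h0 M).trans_lt (hmono (mem_Ici.2 le_rfl) (mem_Ici.2 (by linarith)) (by linarith))
  have h2 := hi.measure_gt_lt_top (half_pos h1)
  refine absurd h2 (not_lt.2 ?_)
  rw [← Real.volume_Ici (a := M + 1)]
  refine measure_mono fun x hx => ?_
  have : f (M + 1) ≤ f x := hmono.monotoneOn (mem_Ici.2 (by linarith))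
    (mem_Ici.2 (by linarith [mem_Ici.1 hx])) hx
  simp only [mem_ofPred_eq]
  linarith

theorem frequently_deriv_nonneg_atBot {f : ℝ → ℝ} (hd : Differentiable ℝ f) (h0 : ∀ x, 0 ≤ f x)
    (hi : Integrable f) : ∃ᶠ x in atBot, 0 ≤ deriv f x := by
  have h := frequently_deriv_nonpos_atTop (f := fun x => f (-x)) (hd.comp differentiable_neg)
    (fun x => h0 _) hi.comp_neg
  have h' : ∃ᶠ x in atTop, 0 ≤ deriv f (-x) :=
    h.mono fun x hx => by rw [deriv_comp_neg] at hx; linarith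
  exact tendsto_neg_atTop_atBot.frequently h'

theorem fisherJ_eq_lintegral_of_nonneg {f : ℝ → ℝ} (hc : Continuous f) (h0 : ∀ x, 0 ≤ f x) :
    fisherJ f = ∫⁻ x, ENNReal.ofReal (curv f x ^ 2 * f x) := by
  unfold fisherJ
  rw [← lintegral_indicator (isOpen_lt continuous_const hc).measurableSet]
  refine lintegral_congr fun x => ?_
  by_cases hx : 0 < f x
  · simp [indicator, hx, curv]
  · simp [indicator, le_antisymm (not_lt.1 hx) (h0 x)]

/-! ### Regularity and integrability for a single density -/

/-- The standing hypotheses on a density. -/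
structure IsAdmissible (f : ℝ → ℝ) : Prop where
  density : IsLogConcaveDensity f
  acDeriv : HasLocallyACDeriv f
  fisherJ_lt : fisherJ f < ∞

namespace IsAdmissible

variable {f : ℝ → ℝ} (hf : IsAdmissible f)
include hf

theorem nonneg (x : ℝ) : 0 ≤ f x := hf.density.nonneg x
theorem differentiable : Differentiable ℝ f := hf.acDeriv.1
theorem hasDerivAt (x : ℝ) : HasDerivAt f (deriv f x) x := (hf.differentiable x).hasDerivAt
theorem continuous : Continuous f := hf.differentiable.continuous
theorem integrable : Integrable f := hf.density.integrable

theorem isOpen_pos : IsOpen {x | 0 < f x} := isOpen_lt continuous_const hf.continuous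

theorem continuous_deriv : Continuous (deriv f) := continuous_iff_continuousAt.2 fun x =>
  (hf.acDeriv.2 (x - 1) (x + 1)).continuousOn.continuousAt <| by
    rw [uIcc_of_le (by linarith)]; exact Icc_mem_nhds (by linarith) (by linarith)

theorem deriv_eq_zero {x : ℝ} (hx : f x = 0) : deriv f x = 0 :=
  IsLocalMin.deriv_eq_zero (Eventually.of_forall fun y => hx ▸ hf.nonneg y)

theorem score_mul (x : ℝ) : score f x * f x = deriv f x := by
  by_cases hx : f x = 0
  · simp [hx, hf.deriv_eq_zero hx]
  · exact div_mul_cancel₀ _ hx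

theorem continuousOn_score : ContinuousOn (score f) {x | 0 < f x} :=
  hf.continuous_deriv.continuousOn.div hf.continuous.continuousOn fun _ hx => ne_of_gt hx

theorem antitoneOn_score : AntitoneOn (score f) {x | 0 < f x} := by
  have h := hf.density.logConcave.antitoneOn_deriv fun x hx =>
    ((hf.hasDerivAt x).log (ne_of_gt hx)).differentiableAt
  intro x hx y hy hxy
  have := h hx hy hxy
  rwa [((hf.hasDerivAt x).log (ne_of_gt hx)).deriv,
    ((hf.hasDerivAt y).log (ne_of_gt hy)).deriv] at this

theorem hasDerivAt_score {x : ℝ} (hx : 0 < f x) (hd : DifferentiableAt ℝ (deriv f) x) :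
    HasDerivAt (score f) (-curv f x) x := by
  refine (hd.hasDerivAt.div (hf.hasDerivAt x) hx.ne').congr_deriv ?_
  simp only [curv]; field_simp; ring

theorem curv_nonneg (x : ℝ) : 0 ≤ curv f x := by
  rcases (hf.nonneg x).eq_or_lt with hx | hx
  · simp [curv, ← hx]
  by_cases hd : DifferentiableAt ℝ (deriv f) x
  · have h2 := hf.antitoneOn_score.derivWithin_nonpos (x := x)
    rw [derivWithin_of_mem_nhds (hf.isOpen_pos.mem_nhds hx),
      (hf.hasDerivAt_score hx hd).deriv] at h2
    linarith
  -- Here `deriv (deriv f) x` takes the default value 0, which leaves a square.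
  · simp only [curv, deriv_zero_of_not_differentiableAt hd, zero_div, sub_zero]
    positivity

/-- The convex set `{f > 0}` has a null frontier; inside it this is algebra, and off its closure `f`
vanishes locally. -/
theorem deriv_deriv_ae :
    deriv (deriv f) =ᵐ[volume] fun x => score f x ^ 2 * f x - curv f x * f x := by
  have h0 : volume (frontier {x | 0 < f x}) = 0 := hf.density.logConcave.1.addHaar_frontier _
  filter_upwards [measure_eq_zero_iff_ae_notMem.1 h0] with x hx
  by_cases hp : 0 < f x
  · simp only [score, curv]
    field_simp; ring
  · have hx0 : f x = 0 := le_antisymm (not_lt.1 hp) (hf.nonneg x)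
    have hxc : x ∉ closure {x | 0 < f x} := fun hc =>
      hx ⟨hc, by rwa [hf.isOpen_pos.interior_eq]⟩
    have hev : f =ᶠ[𝓝 x] fun _ => 0 := by
      filter_upwards [isClosed_closure.isOpen_compl.mem_nhds hxc] with y hy
      exact le_antisymm (not_lt.1 fun h => hy (subset_closure h)) (hf.nonneg y)
    have := hev.deriv.deriv_eq
    simp [this, hx0]

theorem measurable_curv : Measurable (curv f) :=
  (((measurable_deriv f).div hf.continuous.measurable).pow_const 2).sub
    ((measurable_deriv _).div hf.continuous.measurable)

theorem fisherJ_eq_lintegral : fisherJ f = ∫⁻ x, ENNReal.ofReal (curv f x ^ 2 * f x) :=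
  fisherJ_eq_lintegral_of_nonneg hf.continuous hf.nonneg

theorem fisherI_eq_lintegral : fisherI f = ∫⁻ x, ENNReal.ofReal (score f x ^ 2 * f x) := by
  unfold fisherI
  rw [← lintegral_indicator hf.isOpen_pos.measurableSet]
  refine lintegral_congr fun x => ?_
  by_cases hx : 0 < f x
  · simp only [indicator, hx, score, mem_ofPred_eq, if_true]
    congr 1; field_simp
  · simp [indicator, le_antisymm (not_lt.1 hx) (hf.nonneg x)]

theorem integrable_curv_sq_mul : Integrable fun x => curv f x ^ 2 * f x := by
  refine ⟨((hf.measurable_curv.pow_const 2).mul hf.continuous.measurable).aestronglyMeasurable, ?_⟩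
  rw [hasFiniteIntegral_iff_ofReal
    (ae_of_all _ fun x => mul_nonneg (sq_nonneg _) (hf.nonneg x)), ← hf.fisherJ_eq_lintegral]
  exact hf.fisherJ_lt

theorem integrable_curv_mul : Integrable fun x => curv f x * f x := by
  refine (hf.integrable_curv_sq_mul.add hf.integrable).mono'
    (hf.measurable_curv.mul hf.continuous.measurable).aestronglyMeasurable (ae_of_all _ fun x => ?_)
  have h0 := hf.nonneg x
  rw [Real.norm_of_nonneg (mul_nonneg (hf.curv_nonneg x) h0), Pi.add_apply]
  nlinarith [mul_nonneg h0 (sq_nonneg (curv f x - 1)), mul_nonneg h0 (sq_nonneg (curv f x))]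

/-- Integrate score² f = f'' + curv f · f over intervals `[a i, b i]` exhausting the line, with f' ≥
0 at the left end and f' ≤ 0 at the right end. The boundary terms are then nonpositive, so the
integrals are bounded by that of curv f · f. -/
theorem integrable_score_sq_mul : Integrable fun x => score f x ^ 2 * f x := by
  obtain ⟨b, hb, hb'⟩ := exists_seq_forall_of_frequently
    (frequently_deriv_nonpos_atTop hf.differentiable hf.nonneg hf.integrable)
  obtain ⟨a, ha, ha'⟩ := exists_seq_forall_of_frequently
    (frequently_deriv_nonneg_atBot hf.differentiable hf.nonneg hf.integrable)
  have hae : (fun x => score f x ^ 2 * f x) =ᵐ[volume]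
      fun x => deriv (deriv f) x + curv f x * f x :=
    hf.deriv_deriv_ae.mono fun x hx => by simp only [hx]; ring
  have hii : ∀ p q : ℝ, IntervalIntegrable (fun x => score f x ^ 2 * f x) volume p q := fun p q =>
    ((hf.acDeriv.2 p q).intervalIntegrable_deriv.add
      hf.integrable_curv_mul.intervalIntegrable).congr_ae (ae_restrict_of_ae hae.symm)
  refine integrable_of_intervalIntegral_norm_bounded (∫ x, curv f x * f x) (l := atTop)
    (fun i => (hii (a i) (b i)).1) ha hb ?_
  filter_upwards [ha.eventually (eventually_le_atBot 0),
    hb.eventually (eventually_ge_atTop 0)] with i hai hbi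
  have h1 : ∫ x in a i..b i, ‖score f x ^ 2 * f x‖ = (deriv f (b i) - deriv f (a i)) +
      ∫ x in a i..b i, curv f x * f x := by
    rw [← (hf.acDeriv.2 _ _).integral_deriv_eq_sub, ← intervalIntegral.integral_add
      (hf.acDeriv.2 _ _).intervalIntegrable_deriv hf.integrable_curv_mul.intervalIntegrable]
    refine intervalIntegral.integral_congr_ae (hae.mono fun x hx _ => ?_)
    exact (Real.norm_of_nonneg (mul_nonneg (sq_nonneg _) (hf.nonneg x))).trans hx
  have h2 : ∫ x in a i..b i, curv f x * f x ≤ ∫ x, curv f x * f x := by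
    rw [intervalIntegral.integral_of_le (hai.trans hbi)]
    exact setIntegral_le_integral hf.integrable_curv_mul
      (ae_of_all _ fun x => mul_nonneg (hf.curv_nonneg x) (hf.nonneg x))
  rw [h1]
  linarith [hb' i, ha' i]

theorem integrable_deriv : Integrable (deriv f) := by
  refine (hf.integrable_score_sq_mul.add hf.integrable).mono'
    (measurable_deriv f).aestronglyMeasurable (ae_of_all _ fun x => ?_)
  have h0 := hf.nonneg x
  rw [← hf.score_mul x, Real.norm_eq_abs, Pi.add_apply, abs_le]
  constructor <;>
  nlinarith [mul_nonneg h0 (sq_nonneg (score f x - 1)), mul_nonneg h0 (sq_nonneg (score f x)),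
    mul_nonneg h0 (sq_nonneg (score f x + 1))]

theorem integrable_deriv_deriv : Integrable (deriv (deriv f)) :=
  (hf.integrable_score_sq_mul.sub hf.integrable_curv_mul).congr hf.deriv_deriv_ae.symm

/-- Holds because f'' has integral zero. It identifies I(f) with the mean of `curv f`. -/
theorem integral_score_sq_mul : ∫ x, score f x ^ 2 * f x = ∫ x, curv f x * f x := by
  have h := integral_deriv_eq_zero_of_ac hf.acDeriv.2 hf.integrable_deriv hf.integrable_deriv_deriv
  rw [integral_congr_ae hf.deriv_deriv_ae,
    integral_sub hf.integrable_score_sq_mul hf.integrable_curv_mul] at h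
  linarith

theorem fisherJ_eq : fisherJ f = ENNReal.ofReal (∫ x, curv f x ^ 2 * f x) := by
  rw [hf.fisherJ_eq_lintegral, ofReal_integral_eq_lintegral_ofReal hf.integrable_curv_sq_mul
    (ae_of_all _ fun x => mul_nonneg (sq_nonneg _) (hf.nonneg x))]

theorem fisherI_eq : fisherI f = ENNReal.ofReal (∫ x, curv f x * f x) := by
  rw [hf.fisherI_eq_lintegral, ← hf.integral_score_sq_mul,
    ofReal_integral_eq_lintegral_ofReal hf.integrable_score_sq_mul
    (ae_of_all _ fun x => mul_nonneg (sq_nonneg _) (hf.nonneg x))]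

theorem contDiff : ContDiff ℝ 1 f :=
  contDiff_one_iff_deriv.2 ⟨hf.differentiable, hf.continuous_deriv⟩

theorem absolutelyContinuousOnInterval (p q : ℝ) : AbsolutelyContinuousOnInterval f p q :=
  hf.contDiff.contDiffOn.absolutelyContinuousOnInterval

theorem exists_bound : ∃ C, ∀ x, ‖f x‖ ≤ C :=
  exists_bound_of_ac hf.absolutelyContinuousOnInterval hf.integrable_deriv

theorem exists_bound_deriv : ∃ C, ∀ x, ‖deriv f x‖ ≤ C :=
  exists_bound_of_ac hf.acDeriv.2 hf.integrable_deriv_deriv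

end IsAdmissible

/-! ### Differentiating convolutions -/

theorem conv_apply (F G : ℝ → ℝ) (z : ℝ) : conv F G z = ∫ x, F x * G (z - x) := rfl

theorem conv_comm (F G : ℝ → ℝ) : conv F G = conv G F := by
  ext z
  rw [conv_apply, conv_apply, ← integral_sub_left_eq_self (fun x => F x * G (z - x)) volume z]
  exact integral_congr_ae (ae_of_all _ fun x => by simp only [sub_sub_cancel, mul_comm])

section Convolution

variable {F G : ℝ → ℝ}

theorem integrable_mul_comp_sub_right (hF : Integrable F) (hG : Continuous G)
    (hb : ∃ C, ∀ x, ‖G x‖ ≤ C) (z : ℝ) : Integrable fun x => F x * G (z - x) := by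
  obtain ⟨C, hC⟩ := hb
  exact hF.mul_bdd (c := C) (hG.comp (continuous_sub_left z)).aestronglyMeasurable
    (ae_of_all _ fun x => hC _)

theorem integrable_mul_comp_sub_left (hF : Integrable F) (hG : Continuous G)
    (hb : ∃ C, ∀ x, ‖G x‖ ≤ C) (z : ℝ) : Integrable fun x => G x * F (z - x) := by
  have := (integrable_mul_comp_sub_right hF hG hb z).comp_sub_left z
  simpa only [sub_sub_cancel, mul_comm] using this

theorem continuous_conv (hF : Integrable F) (hG : Continuous G) (hb : ∃ C, ∀ x, ‖G x‖ ≤ C) :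
    Continuous (conv F G) := by
  obtain ⟨C, hC⟩ := hb
  refine continuous_of_dominated (F := fun z x => F x * G (z - x)) (bound := fun x => ‖F x‖ * C)
    (fun z => (integrable_mul_comp_sub_right hF hG ⟨C, hC⟩ z).aestronglyMeasurable)
    (fun z => ae_of_all _ fun x => ?_) (hF.norm.mul_const C) (ae_of_all _ fun x => by fun_prop)
  rw [norm_mul]
  exact mul_le_mul_of_nonneg_left (hC _) (norm_nonneg _)

theorem hasDerivAt_conv (hF : Integrable F) (hG : ContDiff ℝ 1 G) (hb : ∃ C, ∀ x, ‖G x‖ ≤ C)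
    (hb' : ∃ C, ∀ x, ‖deriv G x‖ ≤ C) (z : ℝ) :
    HasDerivAt (conv F G) (conv F (deriv G) z) z := by
  have hG' : Continuous (deriv G) := hG.continuous_deriv le_rfl
  have hint := integrable_mul_comp_sub_right hF hG.continuous hb
  have hint' := integrable_mul_comp_sub_right hF hG' hb'
  obtain ⟨C, hC⟩ := hb'
  refine (hasDerivAt_integral_of_dominated_loc_of_deriv_le (F := fun z x => F x * G (z - x))
    (F' := fun z x => F x * deriv G (z - x)) (bound := fun x => ‖F x‖ * C) univ_mem
    (Eventually.of_forall fun z => (hint z).aestronglyMeasurable) (hint z)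
    (hint' z).aestronglyMeasurable (ae_of_all _ fun x y _ => ?_) (hF.norm.mul_const C)
    (ae_of_all _ fun x y _ => ?_)).2
  · rw [norm_mul]
    exact mul_le_mul_of_nonneg_left (hC _) (norm_nonneg _)
  · exact ((hG.differentiable one_ne_zero (y - x)).hasDerivAt.comp_sub_const y x).const_mul (F x)

end Convolution

namespace IsAdmissible

variable {f g : ℝ → ℝ} (hf : IsAdmissible f) (hg : IsAdmissible g)

include hf in
theorem ae_differentiableAt_deriv : ∀ᵐ x, DifferentiableAt ℝ (deriv f) x := by
  have h : ∀ n : ℕ, ∀ᵐ x : ℝ, x ∈ uIcc (-(n : ℝ)) n → DifferentiableAt ℝ (deriv f) x :=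
    fun n => (hf.acDeriv.2 _ _).ae_differentiableAt
  filter_upwards [ae_all_iff.2 h] with x hx
  obtain ⟨n, hn⟩ := exists_nat_ge |x|
  have := abs_le.1 hn
  exact hx n (by rw [uIcc_of_le (by linarith)]; exact this)

include hf hg

theorem hasDerivAt_conv (z : ℝ) : HasDerivAt (conv f g) (conv f (deriv g) z) z :=
  _root_.hasDerivAt_conv hf.integrable hg.contDiff hg.exists_bound hg.exists_bound_deriv z

theorem deriv_conv : deriv (conv f g) = conv f (deriv g) :=
  funext fun z => (hf.hasDerivAt_conv hg z).deriv

theorem deriv_conv' : deriv (conv f g) = conv (deriv f) g := by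
  rw [conv_comm f g, hg.deriv_conv hf, conv_comm]

/-- Placing one derivative on each factor makes the convolution twice differentiable using only
continuous first derivatives. -/
theorem hasDerivAt_deriv_conv (z : ℝ) :
    HasDerivAt (deriv (conv f g)) (conv (deriv f) (deriv g) z) z := by
  rw [hf.deriv_conv' hg]
  exact _root_.hasDerivAt_conv hf.integrable_deriv hg.contDiff hg.exists_bound
    hg.exists_bound_deriv z

theorem deriv_deriv_conv : deriv (deriv (conv f g)) = conv (deriv f) (deriv g) :=
  funext fun z => (hf.hasDerivAt_deriv_conv hg z).deriv

theorem hasLocallyACDeriv_conv : HasLocallyACDeriv (conv f g) := by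
  refine ⟨fun z => (hf.hasDerivAt_conv hg z).differentiableAt, fun p q => ?_⟩
  refine (contDiff_one_iff_deriv.2 ⟨fun z => (hf.hasDerivAt_deriv_conv hg z).differentiableAt,
    ?_⟩).contDiffOn.absolutelyContinuousOnInterval
  rw [hf.deriv_deriv_conv hg]
  exact continuous_conv hf.integrable_deriv hg.continuous_deriv hg.exists_bound_deriv

theorem continuous_conv : Continuous (conv f g) :=
  (hf.hasLocallyACDeriv_conv hg).1.continuous

/-- Integration by parts along the fiber. It links f'', through which the curvature enters, to the
product of the two scores. -/
theorem conv_deriv_deriv (z : ℝ) : conv (deriv f) (deriv g) z = conv (deriv (deriv f)) g z := by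
  have hgz : ContDiff ℝ 1 fun x => g (z - x) := hg.contDiff.comp (contDiff_const.sub contDiff_id)
  have hi1 := integrable_mul_comp_sub_right hf.integrable_deriv_deriv hg.continuous
    hg.exists_bound z
  have hi2 := integrable_mul_comp_sub_right hf.integrable_deriv hg.continuous_deriv
    hg.exists_bound_deriv z
  have hae : deriv (fun x => deriv f x * g (z - x)) =ᵐ[volume]
      fun x => deriv (deriv f) x * g (z - x) - deriv f x * deriv g (z - x) := by
    filter_upwards [hf.ae_differentiableAt_deriv] with x hx
    refine ((hx.hasDerivAt.mul ((hg.hasDerivAt (z - x)).comp_const_sub z x)).congr_deriv ?_).deriv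
    ring
  have h := integral_deriv_eq_zero_of_ac (F := fun x => deriv f x * g (z - x))
    (fun p q => (hf.acDeriv.2 p q).mul hgz.contDiffOn.absolutelyContinuousOnInterval)
    (integrable_mul_comp_sub_right hf.integrable_deriv hg.continuous hg.exists_bound z)
    ((hi1.sub hi2).congr hae.symm)
  rw [integral_congr_ae hae, integral_sub hi1 hi2] at h
  simp only [conv_apply]
  linarith

end IsAdmissible

theorem integral_linear_combination₃ {F₁ F₂ F₃ : ℝ → ℝ} (h₁ : Integrable F₁)
    (h₂ : Integrable F₂) (h₃ : Integrable F₃) (a b c : ℝ) :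
    ∫ x, (a * F₁ x + b * F₂ x + c * F₃ x) =
      a * (∫ x, F₁ x) + b * (∫ x, F₂ x) + c * ∫ x, F₃ x := by
  rw [integral_add (f := fun x => a * F₁ x + b * F₂ x)
      ((h₁.const_mul a).add (h₂.const_mul b)) (h₃.const_mul c),
    integral_add (h₁.const_mul a) (h₂.const_mul b)]
  simp only [integral_const_mul]

theorem integral_linear_combination₄ {F₁ F₂ F₃ F₄ : ℝ → ℝ} (h₁ : Integrable F₁)
    (h₂ : Integrable F₂) (h₃ : Integrable F₃) (h₄ : Integrable F₄) (a b c d : ℝ) :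
    ∫ x, (a * F₁ x + b * F₂ x + c * F₃ x + d * F₄ x) =
      a * (∫ x, F₁ x) + b * (∫ x, F₂ x) + c * (∫ x, F₃ x) + d * ∫ x, F₄ x := by
  rw [integral_add (f := fun x => a * F₁ x + b * F₂ x + c * F₃ x)
      (((h₁.const_mul a).add (h₂.const_mul b)).add (h₃.const_mul c)) (h₄.const_mul d),
    integral_linear_combination₃ h₁ h₂ h₃, integral_const_mul]

/-! ### Conditional moments given the sum -/

/-- The unnormalised conditional density of `X` given `X + Y = z`. -/
noncomputable def fiber (f g : ℝ → ℝ) (z x : ℝ) : ℝ := f x * g (z - x)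

/-- The weighted score `lam f'/f (x) + mu g'/g (z - x)`. -/
noncomputable def wscore (f g : ℝ → ℝ) (lam mu z x : ℝ) : ℝ :=
  lam * score f x + mu * score g (z - x)

/-- The weighted curvature on the fiber over `z`. -/
noncomputable def wcurv (f g : ℝ → ℝ) (lam mu z x : ℝ) : ℝ :=
  lam ^ 2 * curv f x + mu ^ 2 * curv g (z - x)

/-- The second moment of the weighted curvature on the fiber over `z`. -/
noncomputable def wcurvSq (f g : ℝ → ℝ) (lam mu z : ℝ) : ℝ :=
  ∫ x, wcurv f g lam mu z x ^ 2 * fiber f g z x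

/-- The right-hand side of the inequality. -/
noncomputable def jBound (f g : ℝ → ℝ) (lam mu : ℝ) : ℝ :=
  lam ^ 4 * (∫ x, curv f x ^ 2 * f x) + mu ^ 4 * (∫ x, curv g x ^ 2 * g x) +
    2 * lam ^ 2 * mu ^ 2 * ((∫ x, curv f x * f x) * ∫ x, curv g x * g x)

namespace IsAdmissible

variable {f g : ℝ → ℝ} (hf : IsAdmissible f) (hg : IsAdmissible g)

include hf hg

theorem fiber_nonneg (z x : ℝ) : 0 ≤ fiber f g z x := mul_nonneg (hf.nonneg _) (hg.nonneg _)

theorem conv_nonneg (z : ℝ) : 0 ≤ conv f g z := integral_nonneg fun x => hf.fiber_nonneg hg z x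

section

variable (z : ℝ)

theorem integrable_fiber : Integrable (fiber f g z) :=
  integrable_mul_comp_sub_right hf.integrable hg.continuous hg.exists_bound z

omit hg in
theorem score_left_mul_fiber :
    (fun x => score f x * fiber f g z x) = fun x => deriv f x * g (z - x) :=
  funext fun x => by rw [fiber, ← mul_assoc, hf.score_mul]

omit hf in
theorem score_right_mul_fiber :
    (fun x => score g (z - x) * fiber f g z x) = fun x => f x * deriv g (z - x) :=
  funext fun x => by rw [fiber, mul_left_comm, hg.score_mul]

theorem score_mul_score_mul_fiber :
    (fun x => score f x * score g (z - x) * fiber f g z x) =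
      fun x => deriv f x * deriv g (z - x) :=
  funext fun x => by rw [fiber, mul_mul_mul_comm, hf.score_mul, hg.score_mul]

theorem integrable_score_left : Integrable fun x => score f x * fiber f g z x := by
  rw [hf.score_left_mul_fiber]
  exact integrable_mul_comp_sub_right hf.integrable_deriv hg.continuous hg.exists_bound z

theorem integrable_score_right : Integrable fun x => score g (z - x) * fiber f g z x := by
  rw [hg.score_right_mul_fiber]
  exact integrable_mul_comp_sub_right hf.integrable hg.continuous_deriv hg.exists_bound_deriv z

theorem integrable_score_mul_score :
    Integrable fun x => score f x * score g (z - x) * fiber f g z x := by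
  rw [hf.score_mul_score_mul_fiber hg]
  exact integrable_mul_comp_sub_right hf.integrable_deriv hg.continuous_deriv
    hg.exists_bound_deriv z

theorem integrable_score_sq_left : Integrable fun x => score f x ^ 2 * fiber f g z x := by
  simpa only [fiber, mul_assoc] using integrable_mul_comp_sub_right hf.integrable_score_sq_mul
    hg.continuous hg.exists_bound z

theorem integrable_curv_left : Integrable fun x => curv f x * fiber f g z x := by
  simpa only [fiber, mul_assoc] using integrable_mul_comp_sub_right hf.integrable_curv_mul
    hg.continuous hg.exists_bound z

theorem integrable_score_sq_right : Integrable fun x => score g (z - x) ^ 2 * fiber f g z x := by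
  simpa only [fiber, mul_left_comm] using integrable_mul_comp_sub_left hg.integrable_score_sq_mul
    hf.continuous hf.exists_bound z

theorem integrable_curv_right : Integrable fun x => curv g (z - x) * fiber f g z x := by
  simpa only [fiber, mul_left_comm] using integrable_mul_comp_sub_left hg.integrable_curv_mul
    hf.continuous hf.exists_bound z

theorem integral_score_left : ∫ x, score f x * fiber f g z x = deriv (conv f g) z := by
  rw [hf.score_left_mul_fiber, hf.deriv_conv' hg, conv_apply]

theorem integral_score_right : ∫ x, score g (z - x) * fiber f g z x = deriv (conv f g) z := by
  rw [hg.score_right_mul_fiber, hf.deriv_conv hg, conv_apply]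

theorem integral_score_mul_score :
    ∫ x, score f x * score g (z - x) * fiber f g z x = deriv (deriv (conv f g)) z := by
  rw [hf.score_mul_score_mul_fiber hg, hf.deriv_deriv_conv hg, conv_apply]

theorem integral_score_sq_left :
    ∫ x, score f x ^ 2 * fiber f g z x =
      deriv (deriv (conv f g)) z + ∫ x, curv f x * fiber f g z x := by
  rw [hf.deriv_deriv_conv hg, hf.conv_deriv_deriv hg, conv_apply, ← sub_eq_iff_eq_add,
    ← integral_sub (hf.integrable_score_sq_left hg z) (hf.integrable_curv_left hg z)]
  refine integral_congr_ae (hf.deriv_deriv_ae.mono fun x hx => ?_)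
  simp only [hx, fiber]
  ring

omit hf hg in
theorem fiber_comm (x : ℝ) : fiber g f z (z - x) = fiber f g z x := by
  simp only [fiber, sub_sub_cancel, mul_comm]

theorem integral_score_sq_right :
    ∫ x, score g (z - x) ^ 2 * fiber f g z x =
      deriv (deriv (conv f g)) z + ∫ x, curv g (z - x) * fiber f g z x := by
  have h := hg.integral_score_sq_left hf z
  rw [conv_comm, ← integral_sub_left_eq_self (fun x => score g x ^ 2 * fiber g f z x) volume z,
    ← integral_sub_left_eq_self (fun x => curv g x * fiber g f z x) volume z] at h
  simpa only [fiber_comm] using h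

variable (lam mu : ℝ)

theorem integrable_wscore : Integrable fun x => wscore f g lam mu z x * fiber f g z x := by
  refine (((hf.integrable_score_left hg z).const_mul lam).add
    ((hf.integrable_score_right hg z).const_mul mu)).congr (ae_of_all _ fun x => ?_)
  simp only [wscore, Pi.add_apply]; ring

theorem integrable_wcurv : Integrable fun x => wcurv f g lam mu z x * fiber f g z x := by
  refine (((hf.integrable_curv_left hg z).const_mul (lam ^ 2)).add
    ((hf.integrable_curv_right hg z).const_mul (mu ^ 2))).congr (ae_of_all _ fun x => ?_)
  simp only [wcurv, Pi.add_apply]; ring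

theorem integrable_wscore_sq :
    Integrable fun x => wscore f g lam mu z x ^ 2 * fiber f g z x := by
  refine ((((hf.integrable_score_sq_left hg z).const_mul (lam ^ 2)).add
    ((hf.integrable_score_mul_score hg z).const_mul (2 * lam * mu))).add
    ((hf.integrable_score_sq_right hg z).const_mul (mu ^ 2))).congr (ae_of_all _ fun x => ?_)
  simp only [wscore, Pi.add_apply]; ring

variable {lam mu} (h1 : lam + mu = 1)

include h1

theorem integral_wscore :
    ∫ x, wscore f g lam mu z x * fiber f g z x = deriv (conv f g) z := by
  have e : ∀ x, wscore f g lam mu z x * fiber f g z x =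
      lam * (score f x * fiber f g z x) + mu * (score g (z - x) * fiber f g z x) :=
    fun x => by simp only [wscore]; ring
  simp_rw [e]
  rw [integral_add ((hf.integrable_score_left hg z).const_mul _)
    ((hf.integrable_score_right hg z).const_mul _), integral_const_mul, integral_const_mul,
    hf.integral_score_left hg, hf.integral_score_right hg, ← add_mul, h1, one_mul]

theorem integral_wscore_sq :
    ∫ x, wscore f g lam mu z x ^ 2 * fiber f g z x =
      deriv (deriv (conv f g)) z + ∫ x, wcurv f g lam mu z x * fiber f g z x := by
  have e : ∀ x, wscore f g lam mu z x ^ 2 * fiber f g z x =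
      lam ^ 2 * (score f x ^ 2 * fiber f g z x)
        + 2 * lam * mu * (score f x * score g (z - x) * fiber f g z x)
        + mu ^ 2 * (score g (z - x) ^ 2 * fiber f g z x) :=
    fun x => by simp only [wscore]; ring
  have e' : ∀ x, wcurv f g lam mu z x * fiber f g z x =
      lam ^ 2 * (curv f x * fiber f g z x) + mu ^ 2 * (curv g (z - x) * fiber f g z x) :=
    fun x => by simp only [wcurv]; ring
  simp_rw [e, e']
  rw [integral_linear_combination₃ (hf.integrable_score_sq_left hg z)
      (hf.integrable_score_mul_score hg z) (hf.integrable_score_sq_right hg z),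
    integral_add ((hf.integrable_curv_left hg z).const_mul _)
      ((hf.integrable_curv_right hg z).const_mul _)]
  simp only [integral_const_mul]
  rw [hf.integral_score_sq_left hg, hf.integral_score_mul_score hg,
    hf.integral_score_sq_right hg]
  -- The second derivative of the convolution has total coefficient (lam + mu)² = 1.
  linear_combination (deriv (deriv (conv f g)) z) * (lam + mu + 1) * h1

/-- The variance of the weighted score on the fiber over `z`. -/
theorem integral_wscore_sub_sq (hz : 0 < conv f g z) :
    ∫ x, (wscore f g lam mu z x - score (conv f g) z) ^ 2 * fiber f g z x =
      (∫ x, wcurv f g lam mu z x * fiber f g z x) - curv (conv f g) z * conv f g z := by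
  set c := score (conv f g) z with hc
  have e : ∀ x, (wscore f g lam mu z x - c) ^ 2 * fiber f g z x =
      1 * (wscore f g lam mu z x ^ 2 * fiber f g z x)
        + (-(2 * c)) * (wscore f g lam mu z x * fiber f g z x) + c ^ 2 * fiber f g z x :=
    fun x => by ring
  simp_rw [e]
  rw [integral_linear_combination₃ (hf.integrable_wscore_sq hg z lam mu)
      (hf.integrable_wscore hg z lam mu) (hf.integrable_fiber hg z),
    hf.integral_wscore hg z h1, hf.integral_wscore_sq hg z h1]
  have : ∫ x, fiber f g z x = conv f g z := rfl
  rw [this, hc]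
  simp only [score, curv]
  field_simp
  ring

omit h1

/-- Chebyshev's association inequality on the fiber over `z`. -/
theorem conv_mul_deriv_deriv_le :
    conv f g z * deriv (deriv (conv f g)) z ≤ deriv (conv f g) z ^ 2 := by
  set H := conv f g z with hH
  set H' := deriv (conv f g) z with hH'
  set H'' := deriv (deriv (conv f g)) z with hH''
  -- On the fiber `score f x` decreases in x while `score g (z - x)` increases, so their increments
  -- have opposite signs.
  have hpt : ∀ x y, (score f x - score f y) * (score g (z - x) - score g (z - y)) *
      (fiber f g z x * fiber f g z y) ≤ 0 := by
    intro x y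
    rcases (hf.fiber_nonneg hg z x).eq_or_lt with hx | hx
    · simp [← hx]
    rcases (hf.fiber_nonneg hg z y).eq_or_lt with hy | hy
    · simp [← hy]
    have hfx : 0 < f x := pos_of_mul_pos_left hx (hg.nonneg _)
    have hgx : 0 < g (z - x) := pos_of_mul_pos_right hx (hf.nonneg _)
    have hfy : 0 < f y := pos_of_mul_pos_left hy (hg.nonneg _)
    have hgy : 0 < g (z - y) := pos_of_mul_pos_right hy (hf.nonneg _)
    refine mul_nonpos_of_nonpos_of_nonneg ?_ (mul_pos hx hy).le
    rcases le_total x y with h | h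
    · exact mul_nonpos_of_nonneg_of_nonpos (sub_nonneg.2 (hf.antitoneOn_score hfx hfy h))
        (sub_nonpos.2 (hg.antitoneOn_score hgy hgx (by linarith)))
    · exact mul_nonpos_of_nonpos_of_nonneg (sub_nonpos.2 (hf.antitoneOn_score hfy hfx h))
        (sub_nonneg.2 (hg.antitoneOn_score hgx hgy (by linarith)))
  have hk : ∫ x, fiber f g z x = H := rfl
  -- Integrating over x at fixed y, then over y, gives 2 (H H'' - H'²) ≤ 0.
  have hy : ∀ y, H'' * fiber f g z y + -H' * (score f y * fiber f g z y)
      + -H' * (score g (z - y) * fiber f g z y)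
      + H * (score f y * score g (z - y) * fiber f g z y) ≤ 0 := by
    intro y
    have h := integral_nonpos (μ := volume) fun x => hpt x y
    have e : ∀ x, (score f x - score f y) * (score g (z - x) - score g (z - y)) *
        (fiber f g z x * fiber f g z y) =
        fiber f g z y * (score f x * score g (z - x) * fiber f g z x)
        + -(score g (z - y) * fiber f g z y) * (score f x * fiber f g z x)
        + -(score f y * fiber f g z y) * (score g (z - x) * fiber f g z x)
        + score f y * score g (z - y) * fiber f g z y * fiber f g z x := fun x => by ring
    simp_rw [e] at h
    rw [integral_linear_combination₄ (hf.integrable_score_mul_score hg z)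
      (hf.integrable_score_left hg z) (hf.integrable_score_right hg z)
      (hf.integrable_fiber hg z)] at h
    rw [hf.integral_score_mul_score hg, hf.integral_score_left hg, hf.integral_score_right hg,
      hk] at h
    linarith
  have h := integral_nonpos (μ := volume) hy
  rw [integral_linear_combination₄ (hf.integrable_fiber hg z) (hf.integrable_score_left hg z)
    (hf.integrable_score_right hg z) (hf.integrable_score_mul_score hg z)] at h
  rw [hf.integral_score_mul_score hg, hf.integral_score_left hg, hf.integral_score_right hg,
    hk] at h
  linarith

/-- Without this sign, the upper bound for the curvature of the convolution could not be squared. -/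
theorem curv_conv_nonneg : 0 ≤ curv (conv f g) z := by
  rcases (hf.conv_nonneg hg z).eq_or_lt with hz | hz
  · simp [curv, ← hz]
  have h := hf.conv_mul_deriv_deriv_le hg z
  have e : curv (conv f g) z = (deriv (conv f g) z ^ 2
      - conv f g z * deriv (deriv (conv f g)) z) / conv f g z ^ 2 := by
    simp only [curv]; field_simp
  rw [e]
  exact div_nonneg (sub_nonneg.2 h) (sq_nonneg _)

theorem wcurvSq_nonneg (lam mu : ℝ) : 0 ≤ wcurvSq f g lam mu z :=
  integral_nonneg fun x => mul_nonneg (sq_nonneg _) (hf.fiber_nonneg hg z x)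

/-- The Cauchy-Schwarz inequality on the fiber over `z`. -/
theorem sq_integral_wcurv_le
    (hi : Integrable fun x => wcurv f g lam mu z x ^ 2 * fiber f g z x) (hz : 0 < conv f g z) :
    (∫ x, wcurv f g lam mu z x * fiber f g z x) ^ 2 ≤ conv f g z * wcurvSq f g lam mu z := by
  set A := ∫ x, wcurv f g lam mu z x * fiber f g z x with hA
  -- c is the conditional mean of `wcurv`; its conditional variance is nonnegative.
  set c := A / conv f g z with hc
  have h : 0 ≤ ∫ x, (wcurv f g lam mu z x - c) ^ 2 * fiber f g z x :=
    integral_nonneg fun x => mul_nonneg (sq_nonneg _) (hf.fiber_nonneg hg z x)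
  have e : ∀ x, (wcurv f g lam mu z x - c) ^ 2 * fiber f g z x =
      1 * (wcurv f g lam mu z x ^ 2 * fiber f g z x)
        + (-(2 * c)) * (wcurv f g lam mu z x * fiber f g z x) + c ^ 2 * fiber f g z x :=
    fun x => by ring
  simp_rw [e] at h
  rw [integral_linear_combination₃ hi (hf.integrable_wcurv hg z lam mu)
    (hf.integrable_fiber hg z)] at h
  have hk : ∫ x, fiber f g z x = conv f g z := rfl
  rw [hk, ← hA, ← wcurvSq] at h
  have hcA : c * conv f g z = A := div_mul_cancel₀ _ hz.ne'
  nlinarith [mul_nonneg hz.le h]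

end

/-! ### Integrating over the sum: the inequality -/

section

variable (lam mu : ℝ)

omit hf hg in
theorem wcurv_sq_mul_fiber (z x : ℝ) :
    wcurv f g lam mu z x ^ 2 * fiber f g z x =
      lam ^ 4 * (curv f x ^ 2 * f x * g (z - x)) + mu ^ 4 * (f x * (curv g (z - x) ^ 2 * g (z - x)))
      + 2 * lam ^ 2 * mu ^ 2 * (curv f x * f x * (curv g (z - x) * g (z - x))) := by
  simp only [wcurv, fiber]; ring

/-- The cross term convolves two functions known only to be integrable, so it is controlled only for
almost every z. -/
theorem ae_integrable_wcurv_sq :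
    ∀ᵐ z, Integrable (fun x => wcurv f g lam mu z x ^ 2 * fiber f g z x) ∧
      wcurvSq f g lam mu z = lam ^ 4 * conv (fun x => curv f x ^ 2 * f x) g z
        + mu ^ 4 * conv f (fun x => curv g x ^ 2 * g x) z
        + 2 * lam ^ 2 * mu ^ 2 * conv (fun x => curv f x * f x) (fun x => curv g x * g x) z := by
  have H : ∀ {F G : ℝ → ℝ}, Integrable F → Integrable G →
      ∀ᵐ z, Integrable fun x => F x * G (z - x) := fun hF hG =>
    hF.ae_convolution_exists (ContinuousLinearMap.mul ℝ ℝ) hG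
  filter_upwards [H hf.integrable_curv_sq_mul hg.integrable,
    H hf.integrable hg.integrable_curv_sq_mul, H hf.integrable_curv_mul hg.integrable_curv_mul]
    with z h1 h2 h3
  simp_rw [wcurvSq, wcurv_sq_mul_fiber]
  exact ⟨((h1.const_mul _).add (h2.const_mul _)).add (h3.const_mul _),
    integral_linear_combination₃ h1 h2 h3 _ _ _⟩

theorem integrable_wcurvSq_and_integral :
    Integrable (wcurvSq f g lam mu) ∧ ∫ z, wcurvSq f g lam mu z = jBound f g lam mu := by
  have hae := (hf.ae_integrable_wcurv_sq hg lam mu).mono fun z hz => hz.2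
  have H : ∀ {F G : ℝ → ℝ}, Integrable F → Integrable G → Integrable (conv F G) := fun hF hG =>
    hF.integrable_convolution (ContinuousLinearMap.mul ℝ ℝ) hG
  have H' : ∀ {F G : ℝ → ℝ}, Integrable F → Integrable G →
      ∫ z, conv F G z = (∫ z, F z) * ∫ z, G z := fun hF hG =>
    integral_convolution (ContinuousLinearMap.mul ℝ ℝ) hF hG
  have j1 := H hf.integrable_curv_sq_mul hg.integrable
  have j2 := H hf.integrable hg.integrable_curv_sq_mul
  have j3 := H hf.integrable_curv_mul hg.integrable_curv_mul
  refine ⟨(((j1.const_mul _).add (j2.const_mul _)).add (j3.const_mul _)).congr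
    (hae.mono fun z hz => hz.symm), ?_⟩
  rw [integral_congr_ae hae, integral_linear_combination₃ j1 j2 j3,
    H' hf.integrable_curv_sq_mul hg.integrable, H' hf.integrable hg.integrable_curv_sq_mul,
    H' hf.integrable_curv_mul hg.integrable_curv_mul, hf.density.integral_eq_one,
    hg.density.integral_eq_one, one_mul, mul_one, jBound]

variable {lam mu} (h1 : lam + mu = 1)

include h1

theorem curv_conv_sq_mul_le {z : ℝ}
    (hi : Integrable fun x => wcurv f g lam mu z x ^ 2 * fiber f g z x) :
    curv (conv f g) z ^ 2 * conv f g z ≤ wcurvSq f g lam mu z := by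
  rcases (hf.conv_nonneg hg z).eq_or_lt with hz | hz
  · rw [← hz, mul_zero]
    exact hf.wcurvSq_nonneg hg z lam mu
  have h2 := hf.sq_integral_wcurv_le hg z hi hz
  have h3 := hf.integral_wscore_sub_sq hg z h1 hz
  have h4 : 0 ≤ ∫ x, (wscore f g lam mu z x - score (conv f g) z) ^ 2 * fiber f g z x :=
    integral_nonneg fun x => mul_nonneg (sq_nonneg _) (hf.fiber_nonneg hg z x)
  have h5 := mul_nonneg (hf.curv_conv_nonneg hg z) hz.le
  refine le_of_mul_le_mul_left ?_ hz
  nlinarith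

/-- Equality turns Cauchy-Schwarz into ∫ wcurv · fiber ≤ curv h · h with `h = conv f g`, so the
variance is at most zero. -/
theorem integral_wscore_sub_sq_eq_zero {z : ℝ}
    (hi : Integrable fun x => wcurv f g lam mu z x ^ 2 * fiber f g z x) (hz : 0 < conv f g z)
    (heq : curv (conv f g) z ^ 2 * conv f g z = wcurvSq f g lam mu z) :
    ∫ x, (wscore f g lam mu z x - score (conv f g) z) ^ 2 * fiber f g z x = 0 := by
  have h2 := hf.sq_integral_wcurv_le hg z hi hz
  have h3 := hf.integral_wscore_sub_sq hg z h1 hz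
  have h4 : 0 ≤ ∫ x, (wscore f g lam mu z x - score (conv f g) z) ^ 2 * fiber f g z x :=
    integral_nonneg fun x => mul_nonneg (sq_nonneg _) (hf.fiber_nonneg hg z x)
  have h5 := mul_nonneg (hf.curv_conv_nonneg hg z) hz.le
  rw [← heq] at h2
  have h6 := abs_le_of_sq_le_sq (a := ∫ x, wcurv f g lam mu z x * fiber f g z x)
    (by linarith [h2] : _ ≤ (curv (conv f g) z * conv f g z) ^ 2) h5
  linarith [le_of_abs_le h6]

theorem fisherJ_conv_le : fisherJ (conv f g) ≤ ENNReal.ofReal (jBound f g lam mu) := by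
  obtain ⟨hi, he⟩ := hf.integrable_wcurvSq_and_integral hg lam mu
  rw [fisherJ_eq_lintegral_of_nonneg (hf.continuous_conv hg) (hf.conv_nonneg hg), ← he,
    ofReal_integral_eq_lintegral_ofReal hi (ae_of_all _ fun z => hf.wcurvSq_nonneg hg z lam mu)]
  refine lintegral_mono_ae ((hf.ae_integrable_wcurv_sq hg lam mu).mono fun z hz => ?_)
  exact ENNReal.ofReal_le_ofReal (hf.curv_conv_sq_mul_le hg h1 hz.1)

theorem fisherJ_conv_eq_iff : fisherJ (conv f g) = ENNReal.ofReal (jBound f g lam mu) ↔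
    ∀ᵐ z, curv (conv f g) z ^ 2 * conv f g z = wcurvSq f g lam mu z := by
  obtain ⟨hi, he⟩ := hf.integrable_wcurvSq_and_integral hg lam mu
  have hJ := hf.fisherJ_conv_le hg h1
  rw [fisherJ_eq_lintegral_of_nonneg (hf.continuous_conv hg) (hf.conv_nonneg hg)] at hJ ⊢
  rw [← he, ofReal_integral_eq_lintegral_ofReal hi
    (ae_of_all _ fun z => hf.wcurvSq_nonneg hg z lam mu)]
  constructor
  · intro h
    have hle : (fun z => ENNReal.ofReal (curv (conv f g) z ^ 2 * conv f g z)) ≤ᵐ[volume]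
        fun z => ENNReal.ofReal (wcurvSq f g lam mu z) :=
      (hf.ae_integrable_wcurv_sq hg lam mu).mono fun z hz =>
        ENNReal.ofReal_le_ofReal (hf.curv_conv_sq_mul_le hg h1 hz.1)
    have := ae_eq_of_ae_le_of_lintegral_le hle (ne_top_of_le_ne_top ENNReal.ofReal_ne_top hJ)
      hi.aestronglyMeasurable.aemeasurable.ennreal_ofReal h.ge
    refine this.mono fun z hz => ?_
    exact (ENNReal.ofReal_eq_ofReal_iff (mul_nonneg (sq_nonneg _) (hf.conv_nonneg hg z))
      (hf.wcurvSq_nonneg hg z lam mu)).1 hz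
  · intro h
    exact lintegral_congr_ae (h.mono fun z hz => by simp only [hz])

end

end IsAdmissible

/-! ### The equality case: affine scores and Gaussian densities -/

theorem ContinuousOn.eq_const_of_ae_eq {F : ℝ → ℝ} {U : Set ℝ} (hU : IsOpen U)
    (hF : ContinuousOn F U) {c : ℝ} (h : ∀ᵐ x, x ∈ U → F x = c) {x : ℝ} (hx : x ∈ U) :
    F x = c := by
  by_contra hne
  have ho : IsOpen (U ∩ F ⁻¹' {c}ᶜ) := hF.isOpen_inter_preimage hU isOpen_compl_singleton
  have hpos := ho.measure_pos volume ⟨x, hx, hne⟩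
  refine hpos.ne' (measure_mono_null (fun y hy => ?_) (ae_iff.1 h))
  exact fun H => hy.2 (H hy.1)

namespace IsAdmissible

variable {f g : ℝ → ℝ} (hf : IsAdmissible f) (hg : IsAdmissible g)

section

include hf hg

theorem continuous_fiber (z : ℝ) : Continuous (fiber f g z) :=
  hf.continuous.mul (hg.continuous.comp (continuous_sub_left z))

theorem conv_pos {z x : ℝ} (hx : 0 < fiber f g z x) : 0 < conv f g z := by
  refine (integral_pos_iff_support_of_nonneg (fun x => hf.fiber_nonneg hg z x)
    (hf.integrable_fiber hg z)).2 ?_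
  exact (hf.continuous_fiber hg z).isOpen_support.measure_pos volume ⟨x, hx.ne'⟩

theorem wscore_eq_of_variance_eq_zero {lam mu z : ℝ}
    (h0 : ∫ x, (wscore f g lam mu z x - score (conv f g) z) ^ 2 * fiber f g z x = 0)
    {x : ℝ} (hx : 0 < fiber f g z x) : wscore f g lam mu z x = score (conv f g) z := by
  set c := score (conv f g) z
  have hi : Integrable fun x => (wscore f g lam mu z x - c) ^ 2 * fiber f g z x := by
    refine (((hf.integrable_wscore_sq hg z lam mu).sub
      ((hf.integrable_wscore hg z lam mu).const_mul (2 * c))).add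
      ((hf.integrable_fiber hg z).const_mul (c ^ 2))).congr (ae_of_all _ fun x => ?_)
    simp only [Pi.add_apply, Pi.sub_apply]; ring
  have hae := (integral_eq_zero_iff_of_nonneg
    (fun x => mul_nonneg (sq_nonneg _) (hf.fiber_nonneg hg z x)) hi).1 h0
  have hU : IsOpen {x | 0 < fiber f g z x} := isOpen_lt continuous_const (hf.continuous_fiber hg z)
  refine ContinuousOn.eq_const_of_ae_eq hU (F := wscore f g lam mu z) ?_ ?_ hx
  · refine (continuousOn_const.mul (hf.continuousOn_score.mono fun y hy => ?_)).add
      (continuousOn_const.mul (hg.continuousOn_score.comp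
        (continuous_sub_left z).continuousOn fun y hy => ?_))
    · exact pos_of_mul_pos_left hy (hg.nonneg _)
    · exact pos_of_mul_pos_right hy (hf.nonneg _)
  · filter_upwards [hae] with y hy hyU
    have := (mul_eq_zero.1 hy).resolve_right (ne_of_gt hyU)
    exact sub_eq_zero.1 (pow_eq_zero_iff two_ne_zero |>.1 this)

/-- In the equality case the weighted score depends only on the sum of the two variables. -/
theorem score_add_score_eq {lam mu : ℝ} (h1 : lam + mu = 1)
    (heq : fisherJ (conv f g) = ENNReal.ofReal (jBound f g lam mu)) {x y t : ℝ}
    (hx : 0 < f x) (hy : 0 < g y) (hxt : 0 < f (x + t)) (hyt : 0 < g (y - t)) :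
    lam * score f x + mu * score g y = lam * score f (x + t) + mu * score g (y - t) := by
  have hae : ∀ᵐ z, ∀ p q, 0 < fiber f g z p → 0 < fiber f g z q →
      wscore f g lam mu z p = wscore f g lam mu z q := by
    filter_upwards [(hf.fisherJ_conv_eq_iff hg h1).1 heq, hf.ae_integrable_wcurv_sq hg lam mu]
      with z hz hi p q hp hq
    have h0 := hf.integral_wscore_sub_sq_eq_zero hg h1 hi.1 (hf.conv_pos hg hp) hz
    rw [hf.wscore_eq_of_variance_eq_zero hg h0 hp, hf.wscore_eq_of_variance_eq_zero hg h0 hq]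
  -- The relation is known only for almost every sum, so y is shifted by s with x and t fixed;
  -- continuity in s then recovers s = 0.
  have hU : IsOpen {s | 0 < g (y + s) ∧ 0 < g (y - t + s)} :=
    (isOpen_lt continuous_const (hg.continuous.comp (continuous_const_add y))).inter
      (isOpen_lt continuous_const (hg.continuous.comp (continuous_const_add (y - t))))
  have key := ContinuousOn.eq_const_of_ae_eq hU (x := 0)
    (c := lam * score f (x + t) - lam * score f x)
    (F := fun s => mu * score g (y + s) - mu * score g (y - t + s)) ?_ ?_ (by simp [hy, hyt])
  · simp only [add_zero] at key
    linarith
  · refine (continuousOn_const.mul (hg.continuousOn_score.comp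
      (continuous_const_add y).continuousOn fun s hs => hs.1)).sub
      (continuousOn_const.mul (hg.continuousOn_score.comp
      (continuous_const_add (y - t)).continuousOn fun s hs => hs.2))
  · have hq := (measurePreserving_add_left volume (x + y)).quasiMeasurePreserving.ae hae
    filter_upwards [hq] with s hs hsU
    have e1 : x + y + s - x = y + s := by ring
    have e2 : x + y + s - (x + t) = y - t + s := by ring
    have := hs x (x + t) (by rw [fiber, e1]; exact mul_pos hx hsU.1)
      (by rw [fiber, e2]; exact mul_pos hxt hsU.2)
    rw [wscore, wscore, e1, e2] at this
    linarith

/-- With t = y - w the relation writes `score g w` near y through `score f` near `x₀`. One point of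
differentiability of `score f` thus fixes the derivative of `score g` at every point of positivity.
-/
theorem hasDerivAt_score_right {lam mu : ℝ} (hmu : mu ≠ 0)
    (h : ∀ {x y t : ℝ}, 0 < f x → 0 < g y → 0 < f (x + t) → 0 < g (y - t) →
      lam * score f x + mu * score g y = lam * score f (x + t) + mu * score g (y - t))
    {x₀ d : ℝ} (hx₀ : 0 < f x₀) (hd : HasDerivAt (score f) d x₀) {y : ℝ} (hy : 0 < g y) :
    HasDerivAt (score g) (lam * d / mu) y := by
  have hc : HasDerivAt (fun w => score g y + lam / mu * (score f x₀ - score f (x₀ + y - w)))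
      (lam * d / mu) y := by
    have e : x₀ + y - y = x₀ := by ring
    have h1 : HasDerivAt (score f) d (x₀ + y - y) := by rwa [e]
    refine (((h1.comp_const_sub (x₀ + y) y).const_sub _).const_mul (lam / mu)).const_add _
      |>.congr_deriv ?_
    ring
  refine hc.congr_of_eventuallyEq ?_
  have hf_ev : ∀ᶠ w in 𝓝 y, 0 < f (x₀ + y - w) :=
    (hf.continuous.comp (continuous_sub_left (x₀ + y))).continuousAt.eventually_const_lt
      (by simpa using hx₀)
  filter_upwards [hf_ev, hg.isOpen_pos.mem_nhds hy] with w hw1 hw2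
  have e1 : x₀ + (y - w) = x₀ + y - w := by ring
  have e2 : y - (y - w) = w := by ring
  have := h (t := y - w) hx₀ hy (by rwa [e1]) (by rw [e2]; exact hw2)
  rw [e1, e2] at this
  field_simp
  linarith

end

include hf

theorem exists_hasDerivAt_score : ∃ x, 0 < f x ∧ HasDerivAt (score f) (-curv f x) x := by
  have hne : ∃ x, 0 < f x := by
    by_contra! H
    have : f = 0 := funext fun x => le_antisymm (H x) (hf.nonneg x)
    have h1 := hf.density.integral_eq_one
    simp [this] at h1
  have hpos := hf.isOpen_pos.measure_pos volume hne
  obtain ⟨x, hx, hd⟩ := Measure.exists_mem_of_measure_ne_zero_of_ae hpos.ne'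
    (ae_restrict_of_ae hf.ae_differentiableAt_deriv)
  exact ⟨x, hx, hf.hasDerivAt_score hx hd⟩

/-- A density whose score has constant derivative is Gaussian. -/
theorem eq_gaussianPDFReal {k : ℝ} (hk : 0 ≤ k)
    (h : ∀ x, 0 < f x → HasDerivAt (score f) (-k) x) :
    0 < k ∧ ∃ m, f = gaussianPDFReal m (Real.toNNReal (1 / k)) := by
  obtain ⟨x₀, hx₀, -⟩ := hf.exists_hasDerivAt_score
  have haff : ∀ x, 0 < f x → score f x = score f x₀ - k * (x - x₀) := by
    intro x hx
    have hder : ∀ y ∈ {x | 0 < f x}, HasDerivAt (fun w => score f w + k * w) 0 y := fun y hy =>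
      ((h y hy).add ((hasDerivAt_id y).const_mul k)).congr_deriv (by ring)
    have : score f x + k * x = score f x₀ + k * x₀ := hf.isOpen_pos.is_const_of_deriv_eq_zero
      hf.density.logConcave.1.isPreconnected
      (fun y hy => (hder y hy).differentiableAt.differentiableWithinAt)
      (fun y hy => (hder y hy).deriv) hx hx₀
    linarith
  set s := score f x₀
  -- The equation also holds at zeros of `f`, where f' = 0, so solving it on the whole line shows
  -- that `f` never vanishes.
  have hode : ∀ x, deriv f x = (s - k * (x - x₀)) * f x := by
    intro x
    rcases (hf.nonneg x).eq_or_lt with hx | hx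
    · rw [hf.deriv_eq_zero hx.symm, ← hx, mul_zero]
    · rw [← hf.score_mul, haff x hx]
  have hform : ∀ x, f x = f x₀ * Real.exp (s * (x - x₀) - k * (x - x₀) ^ 2 / 2) := by
    have hG : ∀ x, HasDerivAt
        (fun x => f x * Real.exp (k * (x - x₀) ^ 2 / 2 - s * (x - x₀))) 0 x := by
      intro x
      have h1 : HasDerivAt (fun x => k * (x - x₀) ^ 2 / 2 - s * (x - x₀))
          (k * (x - x₀) - s) x := by
        have h2 := (hasDerivAt_id x).sub_const x₀
        refine ((((h2.pow 2).const_mul k).div_const 2).sub (h2.const_mul s)).congr_deriv ?_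
        simp only [id]; push_cast; ring
      refine ((hf.hasDerivAt x).mul h1.exp).congr_deriv ?_
      rw [hode]; ring
    intro x
    have := is_const_of_deriv_eq_zero (fun x => (hG x).differentiableAt)
      (fun x => (hG x).deriv) x x₀
    simp only [sub_self, ne_eq, OfNat.ofNat_ne_zero, not_false_eq_true, zero_pow, mul_zero,
      zero_div, Real.exp_zero, mul_one] at this
    rw [← this, mul_assoc, ← Real.exp_add]
    ring_nf
    simp
  have hpos : ∀ x, 0 < f x := fun x => by rw [hform]; positivity
  have hk0 : 0 < k := by
    -- For k = 0 the logarithmic derivative is the constant s; the signs of f' near both ends force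
    -- s = 0, and a positive constant is not integrable.
    refine hk.lt_of_ne fun hk0 => ?_
    subst hk0
    obtain ⟨x, hx⟩ := (frequently_deriv_nonpos_atTop hf.differentiable hf.nonneg
      hf.integrable).exists
    obtain ⟨y, hy⟩ := (frequently_deriv_nonneg_atBot hf.differentiable hf.nonneg
      hf.integrable).exists
    rw [hode, zero_mul, sub_zero] at hx hy
    have hs : s = 0 := le_antisymm (nonpos_of_mul_nonpos_left hx (hpos x))
      (nonneg_of_mul_nonneg_left hy (hpos y))
    have hconst : f = fun _ => f x₀ := funext fun x => by rw [hform x, hs]; simp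
    have hi := hf.integrable
    rw [hconst, integrable_const_iff] at hi
    rcases hi with hi | hi
    · exact hx₀.ne' hi
    · exact absurd hi.measure_univ_lt_top (by simp)
  refine ⟨hk0, x₀ + s / k, ?_⟩
  set v := Real.toNNReal (1 / k) with hv
  have hvk : (v : ℝ) = 1 / k := Real.coe_toNNReal _ (by positivity)
  have hv0 : v ≠ 0 := by rw [hv, Ne, Real.toNNReal_eq_zero, not_le]; positivity
  -- C collects the constants left by completing the square; total mass one forces C = 1.
  set C := f x₀ * Real.exp (s ^ 2 / (2 * k)) * √(2 * Real.pi * v) with hC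
  have hfC : ∀ x, f x = C * gaussianPDFReal (x₀ + s / k) v x := by
    intro x
    have hsq : √(2 * Real.pi * v) ≠ 0 := by rw [hvk]; positivity
    rw [gaussianPDFReal, hform, hC]
    have : f x₀ * Real.exp (s ^ 2 / (2 * k)) * √(2 * Real.pi * v) *
        ((√(2 * Real.pi * v))⁻¹ * Real.exp (-(x - (x₀ + s / k)) ^ 2 / (2 * v))) =
        f x₀ * (Real.exp (s ^ 2 / (2 * k)) * Real.exp (-(x - (x₀ + s / k)) ^ 2 / (2 * v))) := by
      field_simp
    rw [this, ← Real.exp_add, hvk]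
    congr 2
    field_simp
    ring
  have hC1 : C = 1 := by
    have h1 := hf.density.integral_eq_one
    simp_rw [hfC] at h1
    rwa [integral_const_mul, integral_gaussianPDFReal_eq_one _ hv0, mul_one] at h1
  exact funext fun x => by rw [hfC, hC1, one_mul]

end IsAdmissible

/-! ### Score and curvature of Gaussian densities -/

section Gaussian

variable (m : ℝ) {v : ℝ≥0} (hv : v ≠ 0)

include hv

theorem hasDerivAt_gaussianPDFReal (x : ℝ) :
    HasDerivAt (gaussianPDFReal m v) (-((x - m) / v) * gaussianPDFReal m v x) x := by
  have hv' : (v : ℝ) ≠ 0 := NNReal.coe_ne_zero.2 hv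
  have h1 : HasDerivAt (fun x => -(x - m) ^ 2 / (2 * (v : ℝ))) (-((x - m) / v)) x := by
    refine ((((hasDerivAt_id x).sub_const m).pow 2).neg.div_const (2 * (v : ℝ))).congr_deriv ?_
    simp only [id]; push_cast; field_simp
  refine (h1.exp.const_mul _).congr_deriv ?_
  rw [gaussianPDFReal]; ring

theorem score_gaussianPDFReal (x : ℝ) : score (gaussianPDFReal m v) x = -((x - m) / v) := by
  rw [score, (hasDerivAt_gaussianPDFReal m hv x).deriv,
    mul_div_cancel_right₀ _ (gaussianPDFReal_pos m v x hv).ne']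

theorem curv_gaussianPDFReal (x : ℝ) : curv (gaussianPDFReal m v) x = 1 / v := by
  have hp := (gaussianPDFReal_pos m v x hv).ne'
  have hd : deriv (gaussianPDFReal m v) = fun x => -((x - m) / v) * gaussianPDFReal m v x :=
    funext fun x => (hasDerivAt_gaussianPDFReal m hv x).deriv
  have h2 : HasDerivAt (fun x => -((x - m) / v) * gaussianPDFReal m v x)
      (-(1 / v) * gaussianPDFReal m v x
        + -((x - m) / v) * (-((x - m) / v) * gaussianPDFReal m v x)) x :=
    (((hasDerivAt_id x).sub_const m).div_const (v : ℝ)).neg.mul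
      (hasDerivAt_gaussianPDFReal m hv x)
  rw [curv, hd, h2.deriv]
  field_simp
  ring

end Gaussian

/-! ### Characterisation of equality and conclusion -/

namespace IsAdmissible

variable {f g : ℝ → ℝ} (hf : IsAdmissible f) (hg : IsAdmissible g)

include hf hg

/-- A weighted score depending on z alone has no conditional variance, and a constant weighted
curvature gives equality in Cauchy-Schwarz. -/
theorem fisherJ_conv_eq_of_affine_score {lam mu k : ℝ} {s : ℝ → ℝ} (h1 : lam + mu = 1)
    (hs : ∀ z x, wscore f g lam mu z x = s z) (hk : ∀ z x, wcurv f g lam mu z x = k) :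
    fisherJ (conv f g) = ENNReal.ofReal (jBound f g lam mu) := by
  refine (hf.fisherJ_conv_eq_iff hg h1).2 (ae_of_all _ fun z => ?_)
  have hfib : ∫ x, fiber f g z x = conv f g z := rfl
  have hB : wcurvSq f g lam mu z = k ^ 2 * conv f g z := by
    simp_rw [wcurvSq, hk, integral_const_mul, hfib]
  rw [hB]
  rcases (hf.conv_nonneg hg z).eq_or_lt with hz | hz
  · simp [← hz]
  have hsz : score (conv f g) z = s z := by
    have := hf.integral_wscore hg z h1
    simp_rw [hs, integral_const_mul, hfib] at this
    rw [score, ← this, mul_div_cancel_right₀ _ hz.ne']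
  have hvar := hf.integral_wscore_sub_sq hg z h1 hz
  simp_rw [hs, hsz, hk, integral_const_mul, hfib] at hvar
  have : curv (conv f g) z = k := by
    refine mul_right_cancel₀ hz.ne' ?_
    linarith
  rw [this]

theorem fisherJ_conv_eq_iff_gaussian {a b : ℝ} (ha : 0 < a) (hb : 0 < b) :
    fisherJ (conv f g) = ENNReal.ofReal (jBound f g (a / (a + b)) (b / (a + b))) ↔
      ∃ c : ℝ, 0 < c ∧ ∃ m₁ m₂ : ℝ,
        f = gaussianPDFReal m₁ (Real.toNNReal (c * a)) ∧
        g = gaussianPDFReal m₂ (Real.toNNReal (c * b)) := by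
  have h1 : a / (a + b) + b / (a + b) = 1 := by field_simp
  have hlam : 0 < a / (a + b) := by positivity
  have hmu : 0 < b / (a + b) := by positivity
  constructor
  · intro heq
    have hP := fun {x y t : ℝ} => hf.score_add_score_eq hg h1 heq (x := x) (y := y) (t := t)
    obtain ⟨x₀, hx₀, hd⟩ := hf.exists_hasDerivAt_score
    set k := curv f x₀
    have hk : 0 ≤ k := hf.curv_nonneg x₀
    have hgd : ∀ y, 0 < g y → HasDerivAt (score g) (-(a / b * k)) y := fun y hy =>
      (hf.hasDerivAt_score_right hg hmu.ne' hP hx₀ hd hy).congr_deriv (by field_simp)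
    obtain ⟨y₀, hy₀, -⟩ := hg.exists_hasDerivAt_score
    -- The same argument with the roles of `f` and `g` exchanged, which replaces t by -t, carries
    -- the slope back to all of `{f > 0}`.
    have hfd : ∀ x, 0 < f x → HasDerivAt (score f) (-k) x := fun x hx =>
      (hg.hasDerivAt_score_right hf (lam := b / (a + b)) hlam.ne' (fun {x y t} hx hy hxt hyt => by
        have := hP (t := -t) hy hx (by simpa [sub_eq_add_neg] using hyt) (by simpa using hxt)
        rw [sub_neg_eq_add, ← sub_eq_add_neg] at this
        linarith) hy₀ (hgd y₀ hy₀) hx).congr_deriv (by field_simp)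
    obtain ⟨hk0, m₁, hm₁⟩ := hf.eq_gaussianPDFReal hk hfd
    obtain ⟨-, m₂, hm₂⟩ := hg.eq_gaussianPDFReal (by positivity) hgd
    -- The variances are the inverse slopes 1/k = ca and b/(ak) = cb.
    refine ⟨1 / (k * a), by positivity, m₁, m₂, ?_, ?_⟩
    · convert hm₁ using 3
      field_simp
    · convert hm₂ using 3
      field_simp
  · rintro ⟨c, hc, m₁, m₂, hfG, hgG⟩
    have hva : (Real.toNNReal (c * a) : ℝ) = c * a := Real.coe_toNNReal _ (by positivity)
    have hvb : (Real.toNNReal (c * b) : ℝ) = c * b := Real.coe_toNNReal _ (by positivity)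
    have hva0 : Real.toNNReal (c * a) ≠ 0 := by
      rw [Ne, Real.toNNReal_eq_zero, not_le]; positivity
    have hvb0 : Real.toNNReal (c * b) ≠ 0 := by
      rw [Ne, Real.toNNReal_eq_zero, not_le]; positivity
    refine hf.fisherJ_conv_eq_of_affine_score hg h1 (k := 1 / (c * (a + b)))
      (s := fun z => -((z - m₁ - m₂) / (c * (a + b)))) (fun z x => ?_) (fun z x => ?_)
    · rw [wscore, hfG, hgG, score_gaussianPDFReal _ hva0, score_gaussianPDFReal _ hvb0, hva, hvb]
      field_simp
      ring
    · rw [wcurv, hfG, hgG, curv_gaussianPDFReal _ hva0, curv_gaussianPDFReal _ hvb0, hva, hvb]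
      field_simp

theorem ofReal_jBound {a b : ℝ} (ha : 0 < a) (hb : 0 < b) :
    ENNReal.ofReal (jBound f g (a / (a + b)) (b / (a + b))) =
      ENNReal.ofReal (a ^ 4 / (a + b) ^ 4) * fisherJ f
        + ENNReal.ofReal (b ^ 4 / (a + b) ^ 4) * fisherJ g
        + ENNReal.ofReal (2 * a ^ 2 * b ^ 2 / (a + b) ^ 4) * (fisherI f * fisherI g) := by
  have hJ : ∀ {p : ℝ → ℝ}, IsAdmissible p → 0 ≤ ∫ x, curv p x ^ 2 * p x := fun hp =>
    integral_nonneg fun x => mul_nonneg (sq_nonneg _) (hp.nonneg x)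
  have hI : ∀ {p : ℝ → ℝ}, IsAdmissible p → 0 ≤ ∫ x, curv p x * p x := fun hp =>
    integral_nonneg fun x => mul_nonneg (hp.curv_nonneg x) (hp.nonneg x)
  have hJf := hJ hf
  have hJg := hJ hg
  have hIf := hI hf
  have hIg := hI hg
  rw [hf.fisherJ_eq, hg.fisherJ_eq, hf.fisherI_eq, hg.fisherI_eq, ← ENNReal.ofReal_mul hIf,
    ← ENNReal.ofReal_mul (by positivity), ← ENNReal.ofReal_mul (by positivity),
    ← ENNReal.ofReal_mul (by positivity), ← ENNReal.ofReal_add (by positivity) (by positivity),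
    ← ENNReal.ofReal_add (by positivity) (by positivity), jBound]
  congr 1
  field_simp

end IsAdmissible

theorem theorem1 (f g : ℝ → ℝ)
    (hf : IsLogConcaveDensity f) (hg : IsLogConcaveDensity g)
    (hf' : HasLocallyACDeriv f) (hg' : HasLocallyACDeriv g)
    (hJf : fisherJ f < ∞) (hJg : fisherJ g < ∞) :
    HasLocallyACDeriv (conv f g) ∧ fisherJ (conv f g) < ∞ ∧
    ∀ a b : ℝ, 0 < a → 0 < b →
      (fisherJ (conv f g) ≤
          ENNReal.ofReal (a ^ 4 / (a + b) ^ 4) * fisherJ f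
            + ENNReal.ofReal (b ^ 4 / (a + b) ^ 4) * fisherJ g
            + ENNReal.ofReal (2 * a ^ 2 * b ^ 2 / (a + b) ^ 4) * (fisherI f * fisherI g)) ∧
      (fisherJ (conv f g) =
          ENNReal.ofReal (a ^ 4 / (a + b) ^ 4) * fisherJ f
            + ENNReal.ofReal (b ^ 4 / (a + b) ^ 4) * fisherJ g
            + ENNReal.ofReal (2 * a ^ 2 * b ^ 2 / (a + b) ^ 4) * (fisherI f * fisherI g) ↔
        ∃ c : ℝ, 0 < c ∧ ∃ m₁ m₂ : ℝ,
          f = gaussianPDFReal m₁ (Real.toNNReal (c * a)) ∧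
          g = gaussianPDFReal m₂ (Real.toNNReal (c * b))) := by
  have hF : IsAdmissible f := ⟨hf, hf', hJf⟩
  have hG : IsAdmissible g := ⟨hg, hg', hJg⟩
  -- Finiteness needs only one pair of weights; both are taken to be 1/2.
  refine ⟨hF.hasLocallyACDeriv_conv hG,
    (hF.fisherJ_conv_le hG (add_halves 1)).trans_lt ENNReal.ofReal_lt_top, fun a b ha hb => ?_⟩
  rw [← hF.ofReal_jBound hG ha hb]
  exact ⟨hF.fisherJ_conv_le hG (by field_simp), hF.fisherJ_conv_eq_iff_gaussian hG ha hb⟩
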